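/- **Theorem 1.8.** For every integer $d\ge 1$ there is a constant $C_d$, depending only on $d$, such that the following holds. Let $S\subseteq\mathbb{R}^d$ be a (finite or infinite) set of points in convex position, meaning that no point of $S$ is a convex combination of other points of $S$. Let $n\ge 1$, let $a_1,\dots,a_n\in\mathbb{R}^d$ be nonzero vectors, and let $X=a_1\xi_1+\dots+a_n\xi_n$, where $\xi_1,\dots,\xi_n$ are i.i.d. Rademacher random variables (that is, independent with $\Pr(\xi_i=1)=\Pr(\xi_i=-1)=1/2$). Then 1. $\Pr(X\in S)\le C_d\, n^{-d/2^d}$, and 2. $\Pr(X\in S)\le C_d\, \rho^{1/(d2^{d-1})}$, where $\rho=\max_{x\in\mathbb{R}^d}\Pr(X=x)$. -/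

import Mathlib

open MeasureTheory ProbabilityTheory

/-- `ξ` is a Rademacher random variable on the probability space `(Ω, μ)`:
it takes each of the values `1` and `-1` with probability `1/2`. -/
structure IsRademacher {Ω : Type*} [MeasurableSpace Ω] (ξ : Ω → ℝ) (μ : Measure Ω) : Prop where
  measurable : Measurable ξ
  prob_one : μ {ω | ξ ω = 1} = 1 / 2
  prob_neg_one : μ {ω | ξ ω = -1} = 1 / 2

/-- The random vector `X = a₁ ξ₁ + ⋯ + aₙ ξₙ`. -/
noncomputable def randomSum {Ω : Type*} {d n : ℕ} (a : Fin n → EuclideanSpace ℝ (Fin d))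
    (ξ : Fin n → Ω → ℝ) (ω : Ω) : EuclideanSpace ℝ (Fin d) :=
  ∑ i, ξ i ω • a i

/-- The maximum point concentration probability `ρ = max_x Pr(X = x)`. The supremum below is over
a nonempty family of reals in `[0, 1]`, and it is attained when `X` takes almost surely only
finitely many values, as every sum considered here does. -/
noncomputable def pointConcentration {Ω : Type*} [MeasurableSpace Ω] {d : ℕ}
    (X : Ω → EuclideanSpace ℝ (Fin d)) (μ : Measure Ω) : ℝ :=
  ⨆ x : EuclideanSpace ℝ (Fin d), μ.real {ω | X ω = x}

/-!
Both bounds come from one decoupling inequality (`signProb_le_of_convexPositionMod`): if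
`X = Y₁ + ⋯ + Y_d` with independent `Yᵢ ∈ ℝᵈ` whose point concentrations are all at most `r`, and
`S` is in convex position, then `Pr(X ∈ S) ≤ 2 r ^ (1 / 2 ^ (d - 1))`.

To prove it, say that `S` is in convex position modulo a subspace `W` if no point of `S` is
congruent modulo `W` to a convex combination of other points of `S` (`ConvexPositionMod`). By
Cauchy–Schwarz, `Pr(Y + Z ∈ S) ^ 2` is at most the probability that `Y + Z` and `Y' + Z` both lie in
`S`, for an independent copy `Y'` of `Y`. Up to an event of probability at most `r`, the vector
`v = Y' - Y` is nonzero, and a short convexity argument shows that `S ∩ (S - v)` is in convex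
position modulo `W + ⟨v⟩`; if `v ∈ W`, it is even empty. So each squaring uses up one block and one
dimension, until `W` has codimension at most one, where `S` has at most two points. Because
degenerate differences are harmless, nothing but the point concentration of the blocks matters.

For the bound in terms of `ρ`, the sum is cut into `d` blocks of concentration at most
`2 ρ ^ (1 / d)`: adding a vector at most halves the concentration, and concentration is
supermultiplicative (`exists_split_signConc`).

For the bound in terms of `n`, there is a subspace `U` of some dimension `k ≥ 1` that contains
`k N` disjoint bases of itself among the vectors, with `N` of order `n`
(`exists_submodule_list_bases`). A block of `N` bases has concentration at most `N ^ (-k / 2)`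
(`signProb_sum_linearIndepOn_le`): this case of Halász's inequality follows from Cauchy–Schwarz
alone when `N` is a power of two, as one may then replace all the bases by copies of a single one.
Conditioning on the other vectors and decoupling inside a translate of `U` gives
`n ^ (-k / 2 ^ k)`, which is at most `n ^ (-d / 2 ^ d)`.

Random signed sums are handled through the functional `signAvg`, defined by recursion on the
multiset of vectors; `measureReal_randomSum_mem` translates from an arbitrary probability space.
-/

/-! ### Averages over random signs -/

section SignAverage

variable {V : Type*} [AddCommGroup V]

/-- One averaging step: given an averaging functional `T`, average `T` of the two translates of
`f` by `a` and `-a`. -/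
noncomputable def signStep (a : V) (T : (V → ℝ) → ℝ) (f : V → ℝ) : ℝ :=
  (T (fun x => f (a + x)) + T (fun x => f (-a + x))) / 2

instance signStep_leftCommutative : LeftCommutative (signStep (V := V)) where
  left_comm a b T := by
    funext f
    have h : ∀ u w : V, (fun x => f (u + (w + x))) = fun x => f (w + (u + x)) := by
      intro u w
      funext x
      rw [add_left_comm]
    simp only [signStep]
    rw [h b a, h b (-a), h (-b) a, h (-b) (-a)]
    ring

/-- The expectation of `f (∑ ±a)`, the sum being over the members `a` of the multiset `A`
and the signs being independent and uniform. -/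
noncomputable def signAvg (A : Multiset V) : (V → ℝ) → ℝ :=
  A.foldr signStep (fun f => f 0)

/-- The probability that the random signed sum of the members of `A` lies in `S`. -/
noncomputable def signProb (A : Multiset V) (S : Set V) : ℝ :=
  signAvg A (S.indicator 1)

@[simp] theorem signAvg_zero (f : V → ℝ) : signAvg 0 f = f 0 := by
  simp [signAvg]

theorem signAvg_cons (a : V) (A : Multiset V) (f : V → ℝ) :
    signAvg (a ::ₘ A) f =
      (signAvg A (fun x => f (a + x)) + signAvg A (fun x => f (-a + x))) / 2 := by
  rw [signAvg, Multiset.foldr_cons]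
  rfl

theorem signAvg_add (A B : Multiset V) (f : V → ℝ) :
    signAvg (A + B) f = signAvg A (fun x => signAvg B (fun y => f (x + y))) := by
  induction A using Multiset.induction generalizing f with
  | empty => simp
  | cons a A ih =>
    rw [Multiset.cons_add, signAvg_cons, signAvg_cons, ih, ih]
    simp only [add_assoc]

theorem signAvg_add_fun (A : Multiset V) (f g : V → ℝ) :
    signAvg A (fun x => f x + g x) = signAvg A f + signAvg A g := by
  induction A using Multiset.induction generalizing f g with
  | empty => simp
  | cons a A ih =>
    simp only [signAvg_cons, ih (fun x => f (a + x)), ih (fun x => f (-a + x))]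
    ring

theorem signAvg_const_mul (A : Multiset V) (c : ℝ) (f : V → ℝ) :
    signAvg A (fun x => c * f x) = c * signAvg A f := by
  induction A using Multiset.induction generalizing f with
  | empty => simp
  | cons a A ih =>
    simp only [signAvg_cons, ih (fun x => f (a + x)), ih (fun x => f (-a + x))]
    ring

theorem signAvg_mul_const (A : Multiset V) (c : ℝ) (f : V → ℝ) :
    signAvg A (fun x => f x * c) = signAvg A f * c := by
  simp only [mul_comm _ c, signAvg_const_mul]

@[simp] theorem signAvg_const (A : Multiset V) (c : ℝ) : signAvg A (fun _ => c) = c := by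
  induction A using Multiset.induction with
  | empty => simp
  | cons a A ih => simp [signAvg_cons, ih]

theorem signAvg_mono (A : Multiset V) {f g : V → ℝ} (h : ∀ x, f x ≤ g x) :
    signAvg A f ≤ signAvg A g := by
  induction A using Multiset.induction generalizing f g with
  | empty => simpa using h 0
  | cons a A ih =>
    rw [signAvg_cons, signAvg_cons]
    have h1 := ih (f := fun x => f (a + x)) (g := fun x => g (a + x)) fun x => h _
    have h2 := ih (f := fun x => f (-a + x)) (g := fun x => g (-a + x)) fun x => h _
    linarith

theorem signAvg_sum {ι : Type*} (A : Multiset V) (F : Finset ι) (f : ι → V → ℝ) :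
    signAvg A (fun x => ∑ i ∈ F, f i x) = ∑ i ∈ F, signAvg A (f i) := by
  classical
  induction F using Finset.induction with
  | empty => simp
  | insert i F hi ih =>
    simp only [Finset.sum_insert hi]
    rw [signAvg_add_fun, ih]

/-- Fubini for sign averages. -/
theorem signAvg_comm (A B : Multiset V) (f : V → V → ℝ) :
    signAvg A (fun x => signAvg B (fun y => f x y)) =
      signAvg B (fun y => signAvg A (fun x => f x y)) := by
  induction A using Multiset.induction generalizing f with
  | empty => simp
  | cons a A ih =>
    simp only [signAvg_cons, div_eq_mul_inv, signAvg_mul_const]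
    rw [signAvg_add_fun, ih, ih]

/-- Jensen's inequality for the square. -/
theorem sq_signAvg_le (A : Multiset V) (f : V → ℝ) :
    signAvg A f ^ 2 ≤ signAvg A (fun x => f x ^ 2) := by
  induction A using Multiset.induction generalizing f with
  | empty => simp
  | cons a A ih =>
    rw [signAvg_cons, signAvg_cons]
    have h1 := ih (fun x => f (a + x))
    have h2 := ih (fun x => f (-a + x))
    nlinarith [sq_nonneg (signAvg A (fun x => f (a + x)) - signAvg A (fun x => f (-a + x)))]

theorem signAvg_comp_neg (A : Multiset V) (f : V → ℝ) :
    signAvg A (fun x => f (-x)) = signAvg A f := by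
  induction A using Multiset.induction generalizing f with
  | empty => simp
  | cons a A ih =>
    rw [signAvg_cons, signAvg_cons, ← ih (fun x => f (a + x)), ← ih (fun x => f (-a + x))]
    simp only [neg_add, neg_neg]
    ring

/-- A sign average only sees the values of the function on any subgroup containing the vectors. -/
theorem signAvg_congr {A : Multiset V} (U : AddSubgroup V) (hA : ∀ a ∈ A, a ∈ U) {f g : V → ℝ}
    (h : ∀ x ∈ U, f x = g x) : signAvg A f = signAvg A g := by
  induction A using Multiset.induction generalizing f g with
  | empty => simpa using h 0 U.zero_mem
  | cons a A ih =>
    have ha : a ∈ U := hA a (Multiset.mem_cons_self a A)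
    have hA' : ∀ b ∈ A, b ∈ U := fun b hb => hA b (Multiset.mem_cons_of_mem hb)
    rw [signAvg_cons, signAvg_cons,
      ih hA' (f := fun x => f (a + x)) (g := fun x => g (a + x)) fun x hx =>
        h _ (U.add_mem ha hx),
      ih hA' (f := fun x => f (-a + x)) (g := fun x => g (-a + x)) fun x hx =>
        h _ (U.add_mem (U.neg_mem ha) hx)]

theorem exists_finset_signAvg_congr (A : Multiset V) :
    ∃ F : Finset V, ∀ f g : V → ℝ, (∀ x ∈ F, f x = g x) → signAvg A f = signAvg A g := by
  classical
  induction A using Multiset.induction with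
  | empty => exact ⟨{0}, fun f g h => by simpa using h 0 (by simp)⟩
  | cons a A ih =>
    obtain ⟨F, hF⟩ := ih
    refine ⟨F.image (a + ·) ∪ F.image (-a + ·), fun f g h => ?_⟩
    rw [signAvg_cons, signAvg_cons]
    rw [hF (fun x => f (a + x)) (fun x => g (a + x)) fun x hx => h _
        (Finset.mem_union_left _ (Finset.mem_image_of_mem _ hx)),
      hF (fun x => f (-a + x)) (fun x => g (-a + x)) fun x hx => h _
        (Finset.mem_union_right _ (Finset.mem_image_of_mem _ hx))]

/-- A sign average is a finite sum weighted by point probabilities, over any sufficiently large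
finite set. -/
theorem exists_finset_signAvg_eq_sum (A : Multiset V) :
    ∃ F : Finset V, ∀ G, F ⊆ G → ∀ f : V → ℝ,
      signAvg A f = ∑ x ∈ G, signProb A {x} * f x := by
  classical
  obtain ⟨F, hF⟩ := exists_finset_signAvg_congr A
  refine ⟨F, fun G hG f => ?_⟩
  rw [hF f (fun y => ∑ x ∈ G, ({x} : Set V).indicator 1 y * f x), signAvg_sum]
  · exact Finset.sum_congr rfl fun x _ => signAvg_mul_const A _ _
  · intro y hy
    rw [Finset.sum_eq_single y]
    · simp
    · intro b _ hb
      simp [Set.indicator_of_notMem (show y ∉ ({b} : Set V) from fun h => hb h.symm)]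
    · exact fun h => absurd (hG hy) h

theorem signProb_nonneg (A : Multiset V) (S : Set V) : 0 ≤ signProb A S := by
  rw [← signAvg_const A 0]
  exact signAvg_mono A fun x => Set.indicator_nonneg (fun _ _ => zero_le_one) x

theorem signProb_le_one (A : Multiset V) (S : Set V) : signProb A S ≤ 1 := by
  rw [← signAvg_const A 1]
  exact signAvg_mono A fun x => Set.indicator_le_self' (fun _ _ => zero_le_one) x

theorem signProb_add (A B : Multiset V) (S : Set V) :
    signProb (A + B) S = signAvg A (fun x => signProb B {y | x + y ∈ S}) :=
  signAvg_add A B _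

theorem signProb_add_singleton (A B : Multiset V) (x : V) :
    signProb (A + B) {x} = signAvg A (fun y => signProb B {x - y}) := by
  rw [signProb_add]
  congr 1
  funext y
  congr 1
  ext z
  simp [eq_sub_iff_add_eq']

theorem signProb_singleton_neg (A : Multiset V) (x : V) : signProb A {-x} = signProb A {x} := by
  classical
  refine (signAvg_comp_neg A _).symm.trans (congrArg (signAvg A) (funext fun y => ?_))
  simp [Set.indicator_apply]

/-- If every translate of `S` has probability at most `c` under `A`, then so does `S` under any
multiset containing `A`. -/
theorem signProb_add_le {A : Multiset V} (B : Multiset V) {S : Set V} {c : ℝ}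
    (h : ∀ z, signProb A {y | z + y ∈ S} ≤ c) : signProb (A + B) S ≤ c := by
  rw [add_comm, signProb_add, ← signAvg_const B c]
  exact signAvg_mono B h

/-- The concentration at a point of a sum of two independent symmetric vectors is at most the
average of the return probabilities of the two doubled vectors: the Cauchy–Schwarz
inequality for the convolution, in its arithmetic mean form. -/
theorem signProb_add_singleton_le (A B : Multiset V) (x : V) :
    signProb (A + B) {x} ≤ (signProb (A + A) {0} + signProb (B + B) {0}) / 2 := by
  classical
  obtain ⟨F, hF⟩ := exists_finset_signAvg_eq_sum A
  obtain ⟨G, hG⟩ := exists_finset_signAvg_eq_sum B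
  have hself : ∀ (C : Multiset V), signProb (C + C) {0} = signAvg C (fun y => signProb C {y}) := by
    intro C
    rw [signProb_add_singleton]
    simp only [zero_sub, signProb_singleton_neg]
  have hB : ∑ y ∈ F, signProb B {x - y} ^ 2 ≤ signProb (B + B) {0} := by
    rw [hself, hG (G ∪ F.image (x - ·)) Finset.subset_union_left]
    calc ∑ y ∈ F, signProb B {x - y} ^ 2
        = ∑ z ∈ F.image (x - ·), signProb B {z} * signProb B {z} := by
          rw [Finset.sum_image fun a _ b _ h => sub_right_injective h]
          simp only [sq]
      _ ≤ _ := Finset.sum_le_sum_of_subset_of_nonneg Finset.subset_union_right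
          fun z _ _ => mul_self_nonneg _
  rw [signProb_add_singleton, hself A, hF F subset_rfl, hF F subset_rfl]
  have h : ∑ y ∈ F, signProb A {y} * signProb B {x - y} ≤
      ∑ y ∈ F, (signProb A {y} * signProb A {y} + signProb B {x - y} ^ 2) / 2 :=
    Finset.sum_le_sum fun y _ => by
      nlinarith [sq_nonneg (signProb A {y} - signProb B {x - y})]
  rw [← Finset.sum_div, Finset.sum_add_distrib] at h
  linarith

/-- The power-of-two case of Hölder's inequality for return probabilities: among `2 ^ t`
independent symmetric vectors, one dominates when it replaces all the others. -/
theorem exists_signProb_nsmul_sum_le (s t : ℕ) (l : List (Multiset V)) (hl : l.length = 2 ^ t) :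
    ∃ B ∈ l, signProb (2 ^ s • l.sum) {0} ≤ signProb (2 ^ (s + t) • B) {0} := by
  induction t generalizing s l with
  | zero =>
    obtain ⟨B, rfl⟩ := List.length_eq_one_iff.1 (by simpa using hl)
    exact ⟨B, by simp, by simp⟩
  | succ t ih =>
    obtain ⟨B, hB, hB'⟩ := ih (s + 1) (l.take (2 ^ t)) (by
      rw [List.length_take, hl, pow_succ]; omega)
    obtain ⟨C, hC, hC'⟩ := ih (s + 1) (l.drop (2 ^ t)) (by
      rw [List.length_drop, hl, pow_succ]; omega)
    have h := signProb_add_singleton_le (2 ^ s • (l.take (2 ^ t)).sum)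
      (2 ^ s • (l.drop (2 ^ t)).sum) 0
    rw [← smul_add, List.sum_take_add_sum_drop, ← two_nsmul, ← two_nsmul, smul_smul, smul_smul,
      ← pow_succ'] at h
    rw [show s + (t + 1) = s + 1 + t by ring]
    rcases le_total (signProb (2 ^ (s + 1 + t) • B) {0})
      (signProb (2 ^ (s + 1 + t) • C) {0}) with hle | hle
    · exact ⟨C, List.mem_of_mem_drop hC, by linarith⟩
    · exact ⟨B, List.mem_of_mem_take hB, by linarith⟩

theorem exists_signProb_sum_le (t : ℕ) (l : List (Multiset V)) (hl : l.length = 2 ^ (t + 1))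
    (x : V) : ∃ B ∈ l, signProb l.sum {x} ≤ signProb (2 ^ (t + 1) • B) {0} := by
  obtain ⟨B, hB, hB'⟩ := exists_signProb_nsmul_sum_le 1 t (l.take (2 ^ t)) (by
    rw [List.length_take, hl, pow_succ]; omega)
  obtain ⟨C, hC, hC'⟩ := exists_signProb_nsmul_sum_le 1 t (l.drop (2 ^ t)) (by
    rw [List.length_drop, hl, pow_succ]; omega)
  have h := signProb_add_singleton_le (l.take (2 ^ t)).sum (l.drop (2 ^ t)).sum x
  rw [List.sum_take_add_sum_drop, ← two_nsmul, ← two_nsmul] at h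
  rw [pow_one, add_comm 1 t] at hB' hC'
  rcases le_total (signProb (2 ^ (t + 1) • B) {0})
    (signProb (2 ^ (t + 1) • C) {0}) with hle | hle
  · exact ⟨C, List.mem_of_mem_drop hC, by linarith⟩
  · exact ⟨B, List.mem_of_mem_take hB, by linarith⟩

end SignAverage

/-! ### Return probabilities and Halász's inequality -/

section ReturnProbability

variable {V : Type*} [AddCommGroup V] [Module ℝ V]

theorem signAvg_nsmul_singleton (n : ℕ) (b : V) (f : V → ℝ) :
    signAvg (n • {b}) f * 2 ^ n = ∑ ij ∈ Finset.HasAntidiagonal.antidiagonal n,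
      (n.choose ij.1 : ℝ) * f (((ij.1 : ℝ) - (ij.2 : ℝ)) • b) := by
  induction n generalizing f with
  | zero => simp
  | succ n ih =>
    rw [Finset.sum_antidiagonal_choose_succ_mul (fun i j => f (((i : ℝ) - (j : ℝ)) • b)) n,
      succ_nsmul', Multiset.singleton_add, signAvg_cons]
    have h1 := ih (fun x => f (b + x))
    have h2 := ih (fun x => f (-b + x))
    rw [show (signAvg (n • {b}) (fun x => f (b + x)) + signAvg (n • {b}) (fun x => f (-b + x))) / 2
      * 2 ^ (n + 1) = signAvg (n • {b}) (fun x => f (-b + x)) * 2 ^ n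
        + signAvg (n • {b}) (fun x => f (b + x)) * 2 ^ n by ring, h1, h2]
    congr 1
    · refine Finset.sum_congr rfl fun ij _ => ?_
      congr 2
      push_cast
      module
    · refine Finset.sum_congr rfl fun ij hij => ?_
      rw [Nat.choose_symm_of_eq_add (Finset.HasAntidiagonal.mem_antidiagonal.1 hij).symm]
      congr 2
      push_cast
      module

theorem signProb_nsmul_singleton_zero (m : ℕ) {b : V} (hb : b ≠ 0) :
    signProb ((2 * m) • {b}) {0} = m.centralBinom / 4 ^ m := by
  have h := signAvg_nsmul_singleton (2 * m) b (({0} : Set V).indicator 1)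
  rw [Finset.sum_eq_single (m, m)] at h
  · rw [eq_div_iff (by positivity), show (4 : ℝ) = 2 ^ 2 by norm_num, ← pow_mul]
    simpa [signProb, Nat.centralBinom] using h
  · rintro ⟨i, j⟩ hij hne
    rw [Finset.HasAntidiagonal.mem_antidiagonal] at hij
    rw [Set.indicator_of_notMem, mul_zero]
    simp only [Set.mem_singleton_iff, smul_eq_zero, hb, or_false, sub_eq_zero, Nat.cast_inj]
    rintro rfl
    apply hne
    simp only at hij
    ext <;> simp only <;> omega
  · intro h
    exact absurd (Finset.HasAntidiagonal.mem_antidiagonal.2 (by simp only; omega)) h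

theorem centralBinom_sq_mul_le (m : ℕ) : m.centralBinom ^ 2 * (2 * m + 1) ≤ 16 ^ m := by
  induction m with
  | zero => simp
  | succ m ih =>
    have h := Nat.succ_mul_centralBinom_succ m
    refine le_of_mul_le_mul_left (a := (m + 1) ^ 2) ?_ (by positivity)
    calc (m + 1) ^ 2 * ((m + 1).centralBinom ^ 2 * (2 * (m + 1) + 1))
        = ((m + 1) * (m + 1).centralBinom) ^ 2 * (2 * m + 3) := by ring
      _ = (m.centralBinom ^ 2 * (2 * m + 1)) * (4 * ((2 * m + 1) * (2 * m + 3))) := by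
          rw [h]; ring
      _ ≤ 16 ^ m * (4 * ((2 * m + 1) * (2 * m + 3))) := Nat.mul_le_mul_right _ ih
      _ ≤ 16 ^ m * (4 * (4 * (m + 1) ^ 2)) := by
          refine Nat.mul_le_mul_left _ (Nat.mul_le_mul_left _ ?_)
          nlinarith
      _ = (m + 1) ^ 2 * 16 ^ (m + 1) := by ring

theorem signProb_nsmul_singleton_zero_le {N : ℕ} (hN : Even N) {b : V} (hb : b ≠ 0) :
    signProb (N • {b}) {0} ≤ (√(N + 1 : ℝ))⁻¹ := by
  obtain ⟨m, rfl⟩ := hN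
  have hm : (0 : ℝ) < ((m + m : ℕ) : ℝ) + 1 := by positivity
  rw [← two_mul, signProb_nsmul_singleton_zero m hb, two_mul, ← one_div,
    div_le_div_iff₀ (by positivity) (Real.sqrt_pos.2 hm), one_mul]
  refine le_of_sq_le_sq ?_ (by positivity)
  have h16 : ((4 : ℝ) ^ m) ^ 2 = 16 ^ m := by
    rw [← pow_mul, mul_comm m 2, pow_mul]
    norm_num
  rw [mul_pow, Real.sq_sqrt hm.le, h16, ← two_mul]
  exact_mod_cast centralBinom_sq_mul_le m

/-- The return probability of a linearly independent family, each vector taken `N` times,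
factors over the vectors. -/
theorem signProb_nsmul_linearIndepOn_zero_le {N : ℕ} (hN : Even N) (b : Finset V)
    (hb : LinearIndepOn ℝ id (b : Set V)) :
    signProb (N • b.val) {0} ≤ (√(N + 1 : ℝ))⁻¹ ^ b.card := by
  classical
  induction b using Finset.induction with
  | empty => simp [signProb]
  | insert a s ha ih =>
    rw [Finset.coe_insert, linearIndepOn_id_insert (by simpa using ha)] at hb
    obtain ⟨hs, has⟩ := hb
    have ha0 : a ≠ 0 := fun h => has (h ▸ Submodule.zero_mem _)
    have key : signProb (N • {a} + N • s.val) {0} =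
        signProb (N • {a}) {0} * signProb (N • s.val) {0} := by
      rw [signProb_add_singleton, signProb, ← signAvg_mul_const]
      refine signAvg_congr (Submodule.span ℝ {a}).toAddSubgroup ?_ ?_
      · intro x hx
        rw [Multiset.mem_singleton.1 (Multiset.mem_of_mem_nsmul hx)]
        exact Submodule.mem_span_singleton_self a
      · intro x hx
        obtain ⟨c, rfl⟩ := Submodule.mem_span_singleton.1 hx
        by_cases hc : c = 0
        · simp [hc]
        -- A nonzero multiple of `a` is not a combination of the vectors of `s`.
        · have h0 : signProb (N • s.val) {0 - c • a} = 0 := by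
            rw [signProb, ← signAvg_const (N • s.val) 0]
            refine signAvg_congr (Submodule.span ℝ (s : Set V)).toAddSubgroup ?_ ?_
            · intro x hx
              exact Submodule.subset_span (Multiset.mem_of_mem_nsmul hx)
            · intro x hx
              refine Set.indicator_of_notMem (fun h => has ?_) _
              rw [Set.mem_singleton_iff.1 h, zero_sub] at hx
              exact (Submodule.smul_mem_iff _ hc).1 ((Submodule.neg_mem_iff _).1 hx)
          rw [h0, Set.indicator_of_notMem, zero_mul]
          simp [hc, ha0]
    rw [Finset.insert_val_of_notMem ha, ← Multiset.singleton_add, smul_add, key,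
      Finset.card_insert_of_notMem ha, pow_succ']
    exact mul_le_mul (signProb_nsmul_singleton_zero_le hN ha0) (ih hs) (signProb_nonneg _ _)
      (by positivity)

/-- A special case of Halász's inequality: if `l` consists of `N = 2 ^ (t + 1)` linearly
independent families of `k` vectors each, the concentration of the signed sum is at most
`N ^ (-k / 2)`. -/
theorem signProb_sum_linearIndepOn_le (t k : ℕ) (l : List (Finset V))
    (hl : l.length = 2 ^ (t + 1)) (hind : ∀ b ∈ l, LinearIndepOn ℝ id (b : Set V) ∧ b.card = k)
    (x : V) : signProb (l.map Finset.val).sum {x} ≤ (√(2 ^ (t + 1) : ℝ))⁻¹ ^ k := by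
  obtain ⟨B, hB, hle⟩ := exists_signProb_sum_le t (l.map Finset.val) (by simpa using hl) x
  obtain ⟨b, hb, rfl⟩ := List.mem_map.1 hB
  obtain ⟨hb1, rfl⟩ := hind b hb
  refine hle.trans ((signProb_nsmul_linearIndepOn_zero_le
    (N := 2 ^ (t + 1)) (even_two.pow_of_ne_zero (by omega)) b hb1).trans ?_)
  gcongr
  push_cast
  linarith

end ReturnProbability

/-! ### Convex position modulo a subspace -/

section ConvexPosition

variable {V : Type*} [AddCommGroup V] [Module ℝ V]

open scoped Pointwise in
theorem add_mem_convexHull {S T : Set V} {v p : V} (hp : p ∈ convexHull ℝ S)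
    (h : ∀ q ∈ S, v + q ∈ T) : v + p ∈ convexHull ℝ T := by
  have h1 : v + p ∈ v +ᵥ convexHull ℝ S := ⟨p, hp, rfl⟩
  rw [← convexHull_vadd] at h1
  refine convexHull_mono ?_ h1
  rintro _ ⟨q, hq, rfl⟩
  exact h q hq

/-- `S` is in convex position transversally to the subspace `W`: no point of `S` is congruent
modulo `W` to a convex combination of other points of `S`. For `W = ⊥` this is convex position. -/
def ConvexPositionMod (W : Submodule ℝ V) (S : Set V) : Prop :=
  ∀ t ∈ S, ∀ p ∈ convexHull ℝ (S \ {t}), t - p ∉ W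

namespace ConvexPositionMod

variable {W : Submodule ℝ V} {S : Set V}

theorem sub_notMem (h : ConvexPositionMod W S) {x y : V} (hx : x ∈ S) (hy : y ∈ S)
    (hxy : x ≠ y) : x - y ∉ W :=
  h x hx y (subset_convexHull ℝ _ ⟨hy, hxy.symm⟩)

theorem preimage_add (h : ConvexPositionMod W S) (z : V) :
    ConvexPositionMod W {x | z + x ∈ S} := by
  intro t ht p hp hmem
  refine h (z + t) ht (z + p) (add_mem_convexHull hp ?_) (by simpa using hmem)
  rintro q ⟨hq, hqt⟩
  exact ⟨hq, fun h => hqt (add_left_cancel h)⟩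

/-- The key step: suppose `t - p = w + c • v` with `w ∈ W` and `c ≥ 0`. Moving `p`
towards `t + v`, which is another point of `S`, absorbs the component along `v`. -/
theorem sub_ne_add_smul (h : ConvexPositionMod W S) {t p v w : V} {c : ℝ} (ht : t ∈ S)
    (htv : t + v ∈ S) (hv : v ≠ 0) (hp : p ∈ convexHull ℝ (S \ {t})) (hw : w ∈ W) (hc : 0 ≤ c) :
    t - p ≠ w + c • v := by
  intro heq
  have hc1 : (1 + c) ≠ 0 := by positivity
  have hq : t + v ∈ convexHull ℝ (S \ {t}) :=
    subset_convexHull ℝ _ ⟨htv, by simpa using hv⟩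
  have hmem := convex_convexHull ℝ (S \ {t}) hp hq (a := (1 + c)⁻¹) (b := c * (1 + c)⁻¹)
    (by positivity) (by positivity) (by field_simp)
  refine h t ht _ hmem ?_
  have ht' : t = p + w + c • v := by
    rw [add_assoc, ← heq]
    abel
  have : t - ((1 + c)⁻¹ • p + (c * (1 + c)⁻¹) • (t + v)) = (1 + c)⁻¹ • w := by
    have h1 : t = (1 + c)⁻¹ • ((1 + c) • t) := (inv_smul_smul₀ hc1 t).symm
    have h2 : (1 + c) • t = p + w + c • v + c • t := by
      rw [add_smul, ← ht', one_smul]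
    nth_rw 1 [h1]
    rw [h2]
    module
  rw [this]
  exact W.smul_mem _ hw

/-- Requiring both `t` and `t + v` to lie in `S` makes the set transversal to `v` as well. -/
theorem inter_add (h : ConvexPositionMod W S) {v : V} (hv : v ≠ 0) :
    ConvexPositionMod (W ⊔ Submodule.span ℝ {v}) {t | t ∈ S ∧ t + v ∈ S} := by
  rintro t ⟨ht, htv⟩ p hp hmem
  obtain ⟨w, hw, u, hu, hwu⟩ := Submodule.mem_sup.1 hmem
  obtain ⟨c, rfl⟩ := Submodule.mem_span_singleton.1 hu
  rcases le_total 0 c with hc | hc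
  · refine h.sub_ne_add_smul ht htv hv (convexHull_mono ?_ hp) hw hc hwu.symm
    exact Set.sdiff_subset_sdiff_left fun x hx => hx.1
  -- For `c ≤ 0` the roles of `t` and `t + v` are exchanged.
  · refine h.sub_ne_add_smul (t := t + v) (p := v + p) (v := -v) (c := -c) htv (by simpa using ht)
      (neg_ne_zero.2 hv) ?_ hw (by linarith) ?_
    · refine add_mem_convexHull hp ?_
      rintro q ⟨hq, hqt⟩
      refine ⟨by simpa [add_comm] using hq.2, fun h => hqt ?_⟩
      have h' : v + q = t + v := h
      rw [add_comm] at h'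
      exact add_right_cancel h'
    · rw [neg_smul_neg, hwu]
      abel

theorem exists_subset_pair (h : ConvexPositionMod W S)
    (hW : ∃ v : V ⧸ W, ∀ u : V ⧸ W, ∃ c : ℝ, c • v = u) : ∃ x y, S ⊆ {x, y} := by
  obtain ⟨v, hv⟩ := hW
  choose c hc using fun x : V => hv (W.mkQ x)
  -- Modulo `W`, the point with the middle coordinate lies between the other two.
  have key : ∀ x ∈ S, ∀ y ∈ S, ∀ z ∈ S, x ≠ y → z ≠ y → c x ≤ c y → c y ≤ c z → False := by
    intro x hx y hy z hz hxy hzy h1 h2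
    have hseg : c y ∈ segment ℝ (c x) (c z) := by
      rw [segment_eq_Icc (h1.trans h2)]
      exact ⟨h1, h2⟩
    obtain ⟨α, β, hα, hβ, hαβ, heq⟩ := hseg
    have hp := convex_convexHull ℝ (S \ {y}) (subset_convexHull ℝ _ ⟨hx, hxy⟩)
      (subset_convexHull ℝ _ ⟨hz, hzy⟩) hα hβ hαβ
    refine h y hy _ hp ?_
    rw [← Submodule.ker_mkQ W, LinearMap.mem_ker, map_sub, map_add, map_smul, map_smul, ← hc x,
      ← hc y, ← hc z, ← heq]
    simp only [smul_eq_mul]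
    module
  by_cases hS : S.Subsingleton
  · rcases hS.eq_empty_or_singleton with rfl | ⟨x, rfl⟩
    · exact ⟨0, 0, Set.empty_subset _⟩
    · exact ⟨x, x, by simp⟩
  · obtain ⟨x, hx, y, hy, hxy⟩ := Set.not_subsingleton_iff.1 hS
    refine ⟨x, y, fun z hz => ?_⟩
    by_contra hne
    simp only [Set.mem_insert_iff, Set.mem_singleton_iff, not_or] at hne
    obtain ⟨hzx, hzy⟩ : z ≠ x ∧ z ≠ y := hne
    rcases le_total (c x) (c y) with h1 | h1 <;> rcases le_total (c y) (c z) with h2 | h2 <;>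
      rcases le_total (c x) (c z) with h3 | h3
    · exact key x hx y hy z hz hxy hzy h1 h2
    · exact key x hx y hy z hz hxy hzy h1 h2
    · exact key x hx z hz y hy hzx.symm hzy.symm h3 h2
    · exact key z hz x hx y hy hzx hxy.symm h3 h1
    · exact key y hy x hx z hz hxy.symm hzx h1 h3
    · exact key y hy z hz x hx hzy.symm hzx.symm h2 h3
    · exact key z hz y hy x hx hzy hxy h2 h1
    · exact key z hz y hy x hx hzy hxy h2 h1

end ConvexPositionMod

end ConvexPosition

/-! ### Decoupling -/

section Decoupling

variable {V : Type*} [AddCommGroup V] [Module ℝ V]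

/-- Decoupling: the probability of `S` under a sum of `m + 1` independent blocks, squared, is at
most the probability that both of the sums formed with two independent copies of one block lie in
`S`. Unless the copies agree, the difference `v` of the copies is a new direction to which
`S ∩ (S - v)` is transversal, so the codimension drops by one and `m` blocks remain. -/
theorem signProb_le_of_convexPositionMod [FiniteDimensional ℝ V] (L : List (Multiset V))
    (B₀ : Multiset V) {W : Submodule ℝ V} {S : Set V} (hS : ConvexPositionMod W S)
    (hW : Module.finrank ℝ (V ⧸ W) ≤ L.length + 1) {r : ℝ} (hr : 0 ≤ r)
    (hconc : ∀ B ∈ B₀ :: L, ∀ x, signProb B {x} ≤ r) :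
    signProb (B₀ + L.sum) S ≤ 2 * r ^ ((1 / 2 : ℝ) ^ L.length) := by
  classical
  rcases le_or_gt 1 r with h1 | h1
  · have := Real.one_le_rpow h1 (z := (1 / 2 : ℝ) ^ L.length) (by positivity)
    linarith [signProb_le_one (B₀ + L.sum) S]
  induction L generalizing B₀ W S with
  | nil =>
    obtain ⟨x, y, hxy⟩ := hS.exists_subset_pair (finrank_le_one_iff.1 hW)
    have hle : signProb B₀ S ≤ signProb B₀ {x} + signProb B₀ {y} := by
      rw [signProb, signProb, signProb, ← signAvg_add_fun]
      refine signAvg_mono _ fun z => ?_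
      by_cases hz : z ∈ S
      · rcases hxy hz with rfl | rfl <;> simp only [Set.indicator_apply, hz] <;> simp <;>
          split_ifs <;> norm_num
      · rw [Set.indicator_of_notMem hz]
        exact add_nonneg (Set.indicator_nonneg (fun _ _ => zero_le_one) _)
          (Set.indicator_nonneg (fun _ _ => zero_le_one) _)
    have h := hconc B₀ (by simp)
    simp only [List.sum_nil, add_zero, List.length_nil, pow_zero, Real.rpow_one]
    linarith [h x, h y]
  | cons B₁ L ih =>
    set q : ℝ := r ^ ((1 / 2 : ℝ) ^ L.length) with hq
    have hrq : r ≤ q := by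
      rcases hr.eq_or_lt with h0 | h0
      · rw [← h0]
        positivity
      · calc r = r ^ (1 : ℝ) := (Real.rpow_one r).symm
          _ ≤ q := Real.rpow_le_rpow_of_exponent_ge h0 h1.le
            (pow_le_one₀ (by norm_num) (by norm_num))
    have hconc' : ∀ B ∈ B₀ :: L, ∀ x, signProb B {x} ≤ r := fun B hB =>
      hconc B (by
        rcases List.mem_cons.1 hB with h | h
        · simp [h]
        · simp [h])
    set Z := B₀ + L.sum with hZ
    have hpair : ∀ y y' : V, signProb Z {z | z + y ∈ S ∧ z + y' ∈ S} ≤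
        ({y} : Set V).indicator 1 y' + 2 * q := by
      intro y y'
      by_cases hy : y' = y
      · rw [Set.indicator_of_mem (by simpa using hy)]
        have := signProb_le_one Z {z | z + y ∈ S ∧ z + y' ∈ S}
        have : 0 ≤ q := hr.trans hrq
        simp only [Pi.one_apply]
        linarith
      rw [Set.indicator_of_notMem (by simpa using hy), zero_add]
      have hv : y' - y ≠ 0 := sub_ne_zero.2 hy
      by_cases hvW : y' - y ∈ W
      · have hempty : {z | z + y ∈ S ∧ z + y' ∈ S} = ∅ := by
          ext z
          simp only [Set.mem_ofPred_eq, Set.mem_empty_iff_false, iff_false, not_and]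
          intro hz hz'
          refine hS.sub_notMem hz' hz (fun h => hy (add_left_cancel h)) ?_
          simpa using hvW
        have h0 : signProb Z (∅ : Set V) = 0 := by
          simp [signProb]
        rw [hempty, h0]
        positivity
      · have hlt : W < W ⊔ Submodule.span ℝ {y' - y} := by
          refine lt_of_le_of_ne le_sup_left fun h => hvW ?_
          rw [h]
          exact Submodule.mem_sup_right (Submodule.mem_span_singleton_self _)
        have hfin := Submodule.finrank_lt_finrank_of_lt hlt
        have e1 := Submodule.finrank_quotient_add_finrank W
        have e2 := Submodule.finrank_quotient_add_finrank (W ⊔ Submodule.span ℝ {y' - y})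
        have hset : {z | z + y ∈ S ∧ z + y' ∈ S} =
            {z | y + z ∈ {t | t ∈ S ∧ t + (y' - y) ∈ S}} := by
          ext z
          simp only [Set.mem_ofPred_eq, add_comm z y]
          rw [show y + z + (y' - y) = z + y' by abel]
        rw [hset]
        refine ih B₀ ((hS.inter_add hv).preimage_add y) ?_ hconc'
        rw [List.length_cons] at hW
        omega
    have hsq : signProb (B₀ + (B₁ :: L).sum) S ^ 2 ≤ 3 * q := by
      rw [List.sum_cons, add_left_comm, add_comm, ← hZ, signProb_add]
      refine (sq_signAvg_le _ _).trans ?_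
      have hexp : ∀ z, signProb B₁ {y | z + y ∈ S} ^ 2 = signAvg B₁ (fun y => signAvg B₁ (fun y' =>
          ({z | z + y ∈ S ∧ z + y' ∈ S} : Set V).indicator 1 z)) := by
        intro z
        rw [sq, signProb, ← signAvg_mul_const]
        congr 1
        funext y
        rw [← signAvg_const_mul]
        congr 1
        funext y'
        by_cases h : z + y ∈ S <;> by_cases h' : z + y' ∈ S <;> simp [h, h']
      simp only [hexp]
      rw [signAvg_comm]
      refine (signAvg_mono B₁ (g := fun _ => 3 * q) fun y => ?_).trans_eq (signAvg_const _ _)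
      rw [signAvg_comm]
      refine (signAvg_mono B₁ (hpair y)).trans ?_
      rw [signAvg_add_fun, signAvg_const]
      have : signProb B₁ {y} ≤ r := hconc B₁ (by simp) y
      rw [signProb] at this
      linarith
    have hq2 : (r ^ ((1 / 2 : ℝ) ^ (B₁ :: L).length)) ^ 2 = q := by
      rw [← Real.rpow_natCast, ← Real.rpow_mul hr, hq, List.length_cons, pow_succ]
      congr 1
      push_cast
      ring
    refine le_of_sq_le_sq (hsq.trans ?_) (by positivity)
    rw [mul_pow, hq2]
    linarith

end Decoupling

/-! ### Splitting a sum into blocks of small concentration -/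

section Splitting

variable {V : Type*} [AddCommGroup V]

/-- The largest point probability of the random signed sum of the members of `A`. -/
noncomputable def signConc (A : Multiset V) : ℝ := ⨆ x, signProb A {x}

theorem signProb_le_signConc (A : Multiset V) (x : V) : signProb A {x} ≤ signConc A :=
  le_ciSup (f := fun x => signProb A {x}) ⟨1, by rintro _ ⟨x, rfl⟩; exact signProb_le_one A _⟩ x

theorem signConc_le_one (A : Multiset V) : signConc A ≤ 1 :=
  ciSup_le fun _ => signProb_le_one A _

theorem one_le_signConc_zero : 1 ≤ signConc (0 : Multiset V) := by
  refine le_trans ?_ (signProb_le_signConc 0 0)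
  simp [signProb]

theorem signConc_le_two_mul_cons (a : V) (A : Multiset V) :
    signConc A ≤ 2 * signConc (a ::ₘ A) := by
  refine ciSup_le fun x => ?_
  have h := signProb_le_signConc (a ::ₘ A) (a + x)
  rw [signProb, signAvg_cons] at h
  have h1 : signAvg A (fun y => ({a + x} : Set V).indicator 1 (a + y)) = signProb A {x} := by
    classical
    refine congrArg (signAvg A) (funext fun y => ?_)
    simp [Set.indicator_apply]
  have h2 : 0 ≤ signAvg A (fun y => ({a + x} : Set V).indicator 1 (-a + y)) := by
    rw [← signAvg_const A 0]
    exact signAvg_mono A fun y => Set.indicator_nonneg (fun _ _ => zero_le_one) _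
  linarith

theorem signConc_pos (A : Multiset V) : 0 < signConc A := by
  induction A using Multiset.induction with
  | empty => exact zero_lt_one.trans_le one_le_signConc_zero
  | cons a A ih => linarith [signConc_le_two_mul_cons a A]

theorem signConc_mul_le (A B : Multiset V) : signConc A * signConc B ≤ signConc (A + B) := by
  have h : ∀ x y, signProb A {x} * signProb B {y} ≤ signConc (A + B) := by
    intro x y
    refine le_trans ?_ (signProb_le_signConc (A + B) (x + y))
    rw [signProb_add_singleton, signProb, ← signAvg_mul_const]
    refine signAvg_mono A fun z => ?_
    by_cases hz : z = x
    · simp [hz]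
    · rw [Set.indicator_of_notMem (by simpa using hz), zero_mul]
      exact signProb_nonneg _ _
  have h1 : ∀ y, signConc A * signProb B {y} ≤ signConc (A + B) := by
    intro y
    rw [signConc, Real.iSup_mul_of_nonneg (signProb_nonneg _ _)]
    exact ciSup_le fun x => h x y
  nth_rw 2 [signConc]
  rw [Real.mul_iSup_of_nonneg (signConc_pos A).le]
  exact ciSup_le h1

/-- Adding the vectors one at a time lowers the concentration by at most a factor `2` each time,
so some part of `A` has concentration between `s` and `2 * s`, unless `A` itself has concentration
above `2 * s`. -/
theorem exists_add_signConc (A : Multiset V) {s : ℝ} (hs : s ≤ 1) :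
    ∃ B C, A = B + C ∧ s ≤ signConc B ∧ (signConc B ≤ 2 * s ∨ C = 0) := by
  induction A using Multiset.induction with
  | empty => exact ⟨0, 0, by simp, hs.trans one_le_signConc_zero, Or.inr rfl⟩
  | cons a A ih =>
    obtain ⟨B, C, rfl, h1, h2 | rfl⟩ := ih
    · exact ⟨B, a ::ₘ C, by simp, h1, Or.inl h2⟩
    · rw [add_zero]
      rcases le_total s (signConc (a ::ₘ B)) with h | h
      · exact ⟨a ::ₘ B, 0, by simp, h, Or.inr rfl⟩
      · refine ⟨B, {a}, by rw [add_comm, Multiset.singleton_add], h1, Or.inl ?_⟩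
        linarith [signConc_le_two_mul_cons a B]

/-- If the concentration of `A` is at most `s ^ (m + 1)`, then `A` splits into `m + 1` blocks of
concentration at most `2 * s`. Removing a block of concentration at least `s` leaves a rest of
concentration at most `s ^ m`, by supermultiplicativity. -/
theorem exists_split_signConc (m : ℕ) (A : Multiset V) {s : ℝ} (hs0 : 0 < s) (hs1 : s ≤ 1)
    (hA : signConc A ≤ s ^ (m + 1)) :
    ∃ (B₀ : Multiset V) (L : List (Multiset V)), L.length = m ∧ A = B₀ + L.sum ∧
      ∀ B ∈ B₀ :: L, signConc B ≤ 2 * s := by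
  induction m generalizing A with
  | zero =>
    refine ⟨A, [], rfl, by simp, fun B hB => ?_⟩
    rw [zero_add, pow_one] at hA
    rw [List.mem_singleton.1 hB]
    linarith
  | succ m ih =>
    obtain ⟨B, C, rfl, h1, h2⟩ := exists_add_signConc A hs1
    have hC : signConc C ≤ s ^ (m + 1) := by
      have h : s * signConc C ≤ s * s ^ (m + 1) := by
        rw [← pow_succ']
        exact (mul_le_mul_of_nonneg_right h1 (signConc_pos C).le).trans
          ((signConc_mul_le B C).trans hA)
      exact le_of_mul_le_mul_left h hs0
    have hB : signConc B ≤ 2 * s := by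
      rcases h2 with h2 | rfl
      · exact h2
      · rw [add_zero] at hA
        have : s ^ (m + 1 + 1) ≤ s := pow_le_of_le_one hs0.le hs1 (by omega)
        linarith
    obtain ⟨B₀, L, hL, rfl, hconc⟩ := ih C hC
    refine ⟨B, B₀ :: L, by simp [hL], by simp, fun D hD => ?_⟩
    rcases List.mem_cons.1 hD with rfl | hD
    · exact hB
    · exact hconc D hD

end Splitting

/-! ### Disjoint bases among many vectors -/

section Bases

variable {V : Type*} [AddCommGroup V] [Module ℝ V]

/-- If the vectors of `A` span `U` even after the removal of any `M * finrank U` of them, then `A`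
contains `M` disjoint bases of `U`, found greedily. -/
theorem exists_list_bases [FiniteDimensional ℝ V] (U : Submodule ℝ V) (M : ℕ) (A : Multiset V)
    (hA : ∀ J ≤ A, A.card ≤ J.card + Module.finrank ℝ U * M →
      Submodule.span ℝ {x | x ∈ J} = U) :
    ∃ l : List (Finset V), l.length = M ∧
      (∀ b ∈ l, LinearIndepOn ℝ id (b : Set V) ∧ b.card = Module.finrank ℝ U) ∧
      (l.map Finset.val).sum ≤ A := by
  classical
  induction M generalizing A with
  | zero => exact ⟨[], rfl, by simp, by simp⟩
  | succ M ih =>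
    obtain ⟨b, hbA, hspan, hind⟩ := exists_linearIndependent ℝ {x | x ∈ A}
    rw [hA A le_rfl (by omega)] at hspan
    have hfin : b.Finite := (A.toFinset.finite_toSet).subset fun x hx => by simpa using hbA hx
    lift b to Finset V using hfin
    have hcard : b.card = Module.finrank ℝ U := by
      rw [← hspan]
      exact (finrank_span_finset_eq_card hind).symm
    have hle : b.val ≤ A := (Multiset.le_iff_subset b.nodup).2 fun x hx => hbA hx
    obtain ⟨A', rfl⟩ := Multiset.le_iff_exists_add.1 hle
    obtain ⟨l, hl, hlb, hsum⟩ := ih A' fun J hJ hcJ =>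
      hA J (hJ.trans (Multiset.le_add_left _ _)) (by
        rw [Multiset.card_add, Finset.card_val, hcard, mul_add]
        omega)
    refine ⟨b :: l, by simp [hl], ?_, ?_⟩
    · intro c hc
      rcases List.mem_cons.1 hc with rfl | hc
      · exact ⟨hind, hcard⟩
      · exact hlb c hc
    · simpa using hsum

/-- Among sufficiently many nonzero vectors there are `k * N` disjoint bases of some subspace of
some dimension `k ≥ 1`: take a subspace of least dimension `k` that contains more than `k ^ 3 * N`
of the vectors. -/
theorem exists_submodule_list_bases [FiniteDimensional ℝ V] (N : ℕ) (A : Multiset V)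
    (h0 : ∀ a ∈ A, a ≠ 0) (hA : Module.finrank ℝ V ^ 3 * N < A.card) :
    ∃ (U : Submodule ℝ V) (l : List (Finset V)), Module.finrank ℝ U ≠ 0 ∧
      l.length = Module.finrank ℝ U * N ∧
      (∀ b ∈ l, LinearIndepOn ℝ id (b : Set V) ∧ b.card = Module.finrank ℝ U ∧
        ∀ x ∈ b, x ∈ U) ∧
      (l.map Finset.val).sum ≤ A := by
  classical
  have hex : ∃ k, ∃ U : Submodule ℝ V, Module.finrank ℝ U = k ∧
      k ^ 3 * N < (A.filter (· ∈ U)).card :=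
    ⟨Module.finrank ℝ V, ⊤, finrank_top ℝ V, by simpa using hA⟩
  obtain ⟨U, hUk, hU⟩ := Nat.find_spec hex
  have hmin : ∀ U' : Submodule ℝ V, Module.finrank ℝ U' < Module.finrank ℝ U →
      (A.filter (· ∈ U')).card ≤ Module.finrank ℝ U' ^ 3 * N := by
    intro U' hU'
    by_contra h
    exact Nat.find_min hex (hUk ▸ hU') ⟨U', rfl, not_le.1 h⟩
  rw [← hUk] at hU
  set k := Module.finrank ℝ U with hk
  have hk0 : k ≠ 0 := by
    intro h
    have hbot : U = ⊥ := Submodule.finrank_eq_zero.1 h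
    have : A.filter (· ∈ U) = 0 := by
      rw [Multiset.filter_eq_nil]
      intro a ha
      simpa [hbot] using h0 a ha
    rw [this] at hU
    simp at hU
  obtain ⟨l, hl, hlb, hsum⟩ := exists_list_bases U (k * N) (A.filter (· ∈ U)) (by
    intro J hJ hcard
    have hle : Submodule.span ℝ {x | x ∈ J} ≤ U := Submodule.span_le.2 fun x hx =>
      (Multiset.mem_filter.1 (Multiset.mem_of_le hJ hx)).2
    by_contra hne
    have hlt := Submodule.finrank_lt_finrank_of_lt (lt_of_le_of_ne hle hne)
    have hfew := hmin _ hlt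
    have hJle : J.card ≤ (A.filter (· ∈ Submodule.span ℝ {x | x ∈ J})).card :=
      Multiset.card_le_card (Multiset.le_filter.2
        ⟨hJ.trans (Multiset.filter_le _ _), fun x hx => Submodule.subset_span hx⟩)
    rw [← hk] at hcard hlt
    set j := Module.finrank ℝ (Submodule.span ℝ {x | x ∈ J})
    -- `(k - 1) ^ 3 + k ^ 2 ≤ k ^ 3` for `k ≥ 1`
    have hpoly : j ^ 3 + k * k ≤ k ^ 3 := by
      obtain ⟨i, hi⟩ := Nat.exists_eq_add_of_lt hlt
      rw [hi]
      nlinarith [Nat.zero_le (j * j * i), Nat.zero_le (j * i * i), Nat.zero_le (i * i * i),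
        Nat.zero_le (j * j), Nat.zero_le (j * i), Nat.zero_le (i * i), Nat.zero_le (j ^ 3)]
    have := Nat.mul_le_mul_right N hpoly
    rw [add_mul, mul_assoc] at this
    omega)
  refine ⟨U, l, hk0, hl, fun b hb => ⟨(hlb b hb).1, (hlb b hb).2, fun x hx => ?_⟩,
    hsum.trans (Multiset.filter_le _ _)⟩
  have hbsum : b.val ≤ (l.map Finset.val).sum :=
    List.single_le_sum (fun _ _ => Multiset.zero_le _) _ (List.mem_map_of_mem hb)
  exact (Multiset.mem_filter.1 (Multiset.mem_of_le (hbsum.trans hsum) hx)).2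

theorem List.exists_flatten_eq {α : Type*} (k N : ℕ) (l : List α) (hl : l.length = k * N) :
    ∃ L : List (List α), L.length = k ∧ (∀ c ∈ L, c.length = N) ∧ L.flatten = l := by
  induction k generalizing l with
  | zero => exact ⟨[], rfl, by simp, by simpa [eq_comm] using hl⟩
  | succ k ih =>
    obtain ⟨L, h1, h2, h3⟩ := ih (l.drop N) (by rw [List.length_drop, hl, add_mul]; omega)
    refine ⟨l.take N :: L, by simp [h1], fun c hc => ?_, by simp [h3]⟩
    rcases List.mem_cons.1 hc with rfl | hc
    · rw [List.length_take, hl, add_mul]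
      omega
    · exact h2 c hc

end Bases

/-! ### The two bounds for sign averages -/

section Bounds

theorem natCast_div_two_pow_le {k d : ℕ} (hk : 1 ≤ k) (hkd : k ≤ d) :
    (d : ℝ) / 2 ^ d ≤ k / 2 ^ k := by
  induction d, hkd using Nat.le_induction with
  | base => exact le_rfl
  | succ d hd ih =>
    refine le_trans ?_ ih
    have h1 : (1 : ℝ) ≤ d := by exact_mod_cast hk.trans hd
    rw [div_le_div_iff₀ (by positivity) (by positivity), pow_succ]
    push_cast
    nlinarith [pow_pos (two_pos : (0 : ℝ) < 2) d]

theorem exists_mem_of_mem_sum_map_val {α : Type*} {l : List (Finset α)} {a : α}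
    (ha : a ∈ (l.map Finset.val).sum) : ∃ b ∈ l, a ∈ b := by
  induction l with
  | nil => simp at ha
  | cons b l ih =>
    rw [List.map_cons, List.sum_cons, Multiset.mem_add] at ha
    rcases ha with ha | ha
    · exact ⟨b, by simp, ha⟩
    · obtain ⟨c, hc, hac⟩ := ih ha
      exact ⟨c, List.mem_cons_of_mem _ hc, hac⟩

variable {V : Type*} [AddCommGroup V] [Module ℝ V] [FiniteDimensional ℝ V]

/-- Given `k` blocks, each made of `N` bases of a `k`-dimensional subspace `U`, condition on all
other vectors: the sum is confined to a translate of `U`, where `S` is still in convex position, so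
decoupling applies with Halász's bound for each block. -/
theorem signProb_le_of_pow_lt_card {d : ℕ} (hd : Module.finrank ℝ V = d) (t : ℕ)
    (A : Multiset V) (h0 : ∀ a ∈ A, a ≠ 0) (hA : d ^ 3 * 2 ^ (t + 1) < A.card) {S : Set V}
    (hS : ConvexPositionMod ⊥ S) :
    signProb A S ≤ 2 * (2 ^ (t + 1) : ℝ) ^ (-((d : ℝ) / 2 ^ d)) := by
  obtain ⟨U, l, hU0, hl, hlb, hsum⟩ := exists_submodule_list_bases (2 ^ (t + 1)) A h0 (by rwa [hd])
  have hUd : Module.finrank ℝ U ≤ d := hd ▸ U.finrank_le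
  set k := Module.finrank ℝ U with hk
  set N : ℝ := 2 ^ (t + 1) with hN
  have hN1 : 1 ≤ N := one_le_pow₀ one_le_two
  obtain ⟨L, hLk, hLN, rfl⟩ := List.exists_flatten_eq k (2 ^ (t + 1)) l hl
  obtain ⟨R, rfl⟩ := Multiset.le_iff_exists_add.1 hsum
  refine signProb_add_le R fun z => ?_
  have hmem : ∀ a ∈ (L.flatten.map Finset.val).sum, a ∈ U.toAddSubgroup := by
    intro a ha
    obtain ⟨b, hb, hab⟩ := exists_mem_of_mem_sum_map_val ha
    exact (hlb b hb).2.2 a hab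
  obtain ⟨W, hW⟩ := U.exists_isCompl
  have hrestrict : signProb (L.flatten.map Finset.val).sum {y | z + y ∈ S} =
      signProb (L.flatten.map Finset.val).sum ({y | z + y ∈ S} ∩ U) := by
    refine signAvg_congr U.toAddSubgroup hmem fun x hx => ?_
    have hx' : x ∈ U := hx
    by_cases h : z + x ∈ S <;> simp [h, hx']
  have hconv : ConvexPositionMod W ({y | z + y ∈ S} ∩ (U : Set V)) := by
    rintro p ⟨hp, hpU⟩ q hq hW'
    have hqU : q ∈ U := convexHull_min (fun x hx => hx.1.2) U.convex hq
    have h0 : p - q ∈ (⊥ : Submodule ℝ V) := by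
      rw [← hW.inf_eq_bot]
      exact ⟨U.sub_mem hpU hqU, hW'⟩
    refine hS.preimage_add z p hp q (convexHull_mono ?_ hq) h0
    exact Set.sdiff_subset_sdiff_left Set.inter_subset_left
  have hcodim : Module.finrank ℝ (V ⧸ W) = k :=
    (Submodule.quotientEquivOfIsCompl W U hW.symm).finrank_eq
  have hblock : ∀ c ∈ L, ∀ x, signProb (c.map Finset.val).sum {x} ≤ (√N)⁻¹ ^ k := by
    intro c hc x
    refine signProb_sum_linearIndepOn_le t k c (hLN c hc) (fun b hb => ?_) x
    have := hlb b (List.mem_flatten.2 ⟨c, hc, hb⟩)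
    exact ⟨this.1, this.2.1⟩
  rw [hrestrict]
  cases L with
  | nil => exact absurd hLk.symm hU0
  | cons c L =>
    have hdec := signProb_le_of_convexPositionMod (L.map fun c => (c.map Finset.val).sum)
      (c.map Finset.val).sum hconv
      (by rw [hcodim, ← hLk, List.length_map, List.length_cons]) (r := (√N)⁻¹ ^ k)
      (by positivity) (by
        intro B hB
        rw [← List.map_cons (f := fun c => (List.map Finset.val c).sum)] at hB
        obtain ⟨c', hc', rfl⟩ := List.mem_map.1 hB
        exact hblock c' hc')
    have hsumeq : ((c :: L).flatten.map Finset.val).sum =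
        (c.map Finset.val).sum + (L.map fun c => (c.map Finset.val).sum).sum := by
      rw [List.flatten_cons, List.map_append, List.sum_append, List.map_flatten, List.sum_flatten,
        List.map_map]
      rfl
    rw [hsumeq]
    refine hdec.trans ?_
    have hrpow : ((√N)⁻¹ ^ k) ^ ((1 / 2 : ℝ) ^ (L.map fun c => (c.map Finset.val).sum).length) =
        N ^ (-((k : ℝ) / 2 ^ k)) := by
      rw [List.length_map, Real.sqrt_eq_rpow, ← Real.rpow_neg (by positivity), ← Real.rpow_natCast,
        ← Real.rpow_mul (by positivity), ← Real.rpow_mul (by positivity)]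
      congr 1
      have h2 : (2 : ℝ) ^ k = 2 * 2 ^ L.length := by
        rw [← hLk, List.length_cons, pow_succ']
      rw [h2, one_div_pow]
      field_simp
    rw [hrpow]
    refine mul_le_mul_of_nonneg_left (Real.rpow_le_rpow_of_exponent_le hN1 (neg_le_neg ?_))
      two_pos.le
    exact natCast_div_two_pow_le (Nat.one_le_iff_ne_zero.2 hU0) hUd

/-- The bound in terms of the number of vectors. The number `N` of bases per block is the largest
power of two with `d ^ 3 * N` less than the number of vectors. -/
theorem signProb_le_card_rpow {d : ℕ} (hd : Module.finrank ℝ V = d) (hd1 : 1 ≤ d)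
    (A : Multiset V) (h0 : ∀ a ∈ A, a ≠ 0) (hA : 1 ≤ A.card) {S : Set V}
    (hS : ConvexPositionMod ⊥ S) :
    signProb A S ≤ (4 * d ^ 3 : ℝ) * (A.card : ℝ) ^ (-((d : ℝ) / 2 ^ d)) := by
  set e : ℝ := (d : ℝ) / 2 ^ d with he
  have he0 : 0 ≤ e := by positivity
  have he1 : e ≤ 1 := by
    rw [he, div_le_one (by positivity)]
    exact_mod_cast (Nat.lt_two_pow_self).le
  have hd3 : 0 < d ^ 3 := by positivity
  -- A bound in terms of `N` is enough as long as `N` is at least a constant times the number of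
  -- vectors; `N` will be a power of two, or `1` when there are few vectors.
  have hred : ∀ N : ℝ, 1 ≤ N → (A.card : ℝ) ≤ 2 * d ^ 3 * N → signProb A S ≤ 2 * N ^ (-e) →
      signProb A S ≤ (4 * d ^ 3 : ℝ) * (A.card : ℝ) ^ (-e) := by
    intro N hN hAN h
    have hA0 : (0 : ℝ) < A.card := by exact_mod_cast hA
    have hD : (1 : ℝ) ≤ 2 * d ^ 3 := by
      have : (1 : ℝ) ≤ (d : ℝ) ^ 3 := by exact_mod_cast hd3
      linarith
    have h1 : N ^ (-e) ≤ 2 * d ^ 3 * (A.card : ℝ) ^ (-e) := by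
      have h2 : (A.card : ℝ) ^ e ≤ 2 * d ^ 3 * N ^ e := by
        calc (A.card : ℝ) ^ e ≤ (2 * d ^ 3 * N) ^ e := Real.rpow_le_rpow hA0.le hAN he0
          _ = (2 * d ^ 3) ^ e * N ^ e := Real.mul_rpow (by positivity) (by positivity)
          _ ≤ 2 * d ^ 3 * N ^ e := by
            gcongr
            exact (Real.rpow_le_rpow_of_exponent_le hD he1).trans_eq (Real.rpow_one _)
      rw [Real.rpow_neg (by positivity), Real.rpow_neg hA0.le, ← div_eq_mul_inv, ← one_div,
        div_le_div_iff₀ (by positivity) (by positivity), one_mul]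
      exact h2
    linarith
  set q := (A.card - 1) / d ^ 3 with hq
  have hqlt : A.card - 1 < d ^ 3 * (q + 1) := by
    rw [mul_comm]
    exact Nat.lt_mul_of_div_lt (Nat.lt_succ_self _) hd3
  rcases lt_or_ge q 2 with hq2 | hq2
  · refine hred 1 le_rfl ?_ ?_
    · have : d ^ 3 * (q + 1) ≤ d ^ 3 * 2 := Nat.mul_le_mul_left _ (by omega)
      have : A.card ≤ 2 * d ^ 3 := by omega
      rw [mul_one]
      exact_mod_cast this
    · rw [Real.one_rpow]
      linarith [signProb_le_one A S]
  · have hlog : 1 ≤ Nat.log 2 q := Nat.log_pos (by norm_num) hq2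
    obtain ⟨t, ht⟩ := Nat.exists_eq_add_of_le' hlog
    have hlow : 2 ^ (t + 1) ≤ q := ht ▸ Nat.pow_log_le_self 2 (by omega)
    have hup : q < 2 ^ (t + 1 + 1) := ht ▸ Nat.lt_pow_succ_log_self (by norm_num) q
    refine hred (2 ^ (t + 1)) (one_le_pow₀ one_le_two) ?_
      (signProb_le_of_pow_lt_card hd t A h0 ?_ hS)
    · have h1 : d ^ 3 * (q + 1) ≤ d ^ 3 * 2 ^ (t + 1 + 1) := Nat.mul_le_mul_left _ hup
      have h2 : A.card ≤ 2 * d ^ 3 * 2 ^ (t + 1) := by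
        rw [pow_succ 2 (t + 1)] at h1
        have : 2 * d ^ 3 * 2 ^ (t + 1) = d ^ 3 * (2 ^ (t + 1) * 2) := by ring
        omega
      exact_mod_cast h2
    · have h1 : d ^ 3 * 2 ^ (t + 1) ≤ d ^ 3 * q := Nat.mul_le_mul_left _ hlow
      have h2 : d ^ 3 * q ≤ A.card - 1 := Nat.mul_div_le _ _
      omega

/-- The bound in terms of the concentration: decoupling for `d` blocks of concentration at most
twice the `d`-th root of that of `A`. -/
theorem signProb_le_signConc_rpow {d : ℕ} (hd : Module.finrank ℝ V = d) (hd1 : 1 ≤ d)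
    (A : Multiset V) {S : Set V} (hS : ConvexPositionMod ⊥ S) :
    signProb A S ≤ 4 * signConc A ^ (1 / ((d : ℝ) * 2 ^ (d - 1))) := by
  obtain ⟨m, rfl⟩ := Nat.exists_eq_add_of_le' hd1
  set ρ := signConc A with hρ
  have hρ0 : 0 < ρ := signConc_pos A
  set s : ℝ := ρ ^ (1 / ((m + 1 : ℕ) : ℝ)) with hs
  have hs0 : 0 < s := Real.rpow_pos_of_pos hρ0 _
  have hs1 : s ≤ 1 := Real.rpow_le_one hρ0.le (signConc_le_one A) (by positivity)
  have hpow : ρ = s ^ (m + 1) := by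
    rw [hs, one_div, Real.rpow_inv_natCast_pow hρ0.le (Nat.succ_ne_zero m)]
  obtain ⟨B₀, L, hL, hAeq, hconc⟩ := exists_split_signConc m A hs0 hs1 (hρ ▸ hpow).le
  have hdec := signProb_le_of_convexPositionMod L B₀ hS
    (by rw [(Submodule.quotEquivOfEqBot (⊥ : Submodule ℝ V) rfl).finrank_eq, hd, hL])
    (r := 2 * s) (by positivity)
    (fun B hB x => (signProb_le_signConc B x).trans (hconc B hB))
  rw [← hAeq, hL, Real.mul_rpow two_pos.le hs0.le] at hdec
  have h2 : (2 : ℝ) ^ ((1 / 2 : ℝ) ^ m) ≤ 2 :=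
    (Real.rpow_le_rpow_of_exponent_le one_le_two
      (pow_le_one₀ (by norm_num) (by norm_num))).trans_eq (Real.rpow_one 2)
  have hsr : s ^ ((1 / 2 : ℝ) ^ m) =
      ρ ^ (1 / (((m + 1 : ℕ) : ℝ) * 2 ^ (m + 1 - 1))) := by
    rw [hs, ← Real.rpow_mul hρ0.le, Nat.add_sub_cancel, one_div_pow]
    congr 1
    field_simp
  have hs' : 0 ≤ s ^ ((1 / 2 : ℝ) ^ m) := by positivity
  rw [← hsr]
  nlinarith

end Bounds

/-! ### Sums of Rademacher variables -/

section Rademacher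

theorem signAvg_ofFn {V : Type*} [AddCommGroup V] [Module ℝ V] {n : ℕ} (a : Fin n → V)
    (f : V → ℝ) :
    signAvg (List.ofFn a : Multiset V) f =
      ∑ σ : Fin n → Bool, (1 / 2) ^ n * f (∑ i, (if σ i then (1 : ℝ) else -1) • a i) := by
  induction n generalizing f with
  | zero => simp
  | succ n ih =>
    rw [List.ofFn_succ, ← Multiset.cons_coe, signAvg_cons, ih, ih,
      ← (Fin.consEquiv fun _ => Bool).sum_comp, Fintype.sum_prod_type, Fintype.sum_bool]
    simp only [Fin.consEquiv, Equiv.coe_fn_mk, Fin.sum_univ_succ, Fin.cons_zero, Fin.cons_succ,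
      if_true, Bool.false_eq_true, if_false, one_smul, neg_smul, pow_succ]
    rw [add_div, Finset.sum_div, Finset.sum_div]
    congr 1 <;> refine Finset.sum_congr rfl fun σ _ => ?_ <;> ring

variable {Ω : Type*} [MeasurableSpace Ω] {μ : Measure Ω} [IsProbabilityMeasure μ]

theorem IsRademacher.ae_eq_or {ξ : Ω → ℝ} (h : IsRademacher ξ μ) :
    ∀ᵐ ω ∂μ, ξ ω = 1 ∨ ξ ω = -1 := by
  have hm1 : MeasurableSet {ω | ξ ω = 1} := h.measurable (measurableSet_singleton 1)
  have hm2 : MeasurableSet {ω | ξ ω = -1} := h.measurable (measurableSet_singleton (-1))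
  have hdisj : Disjoint {ω | ξ ω = 1} {ω | ξ ω = -1} := by
    rw [Set.disjoint_left]
    intro ω h1 h2
    rw [Set.mem_ofPred_eq] at h1 h2
    norm_num [h1] at h2
  have hone : μ ({ω | ξ ω = 1} ∪ {ω | ξ ω = -1}) = 1 := by
    rw [measure_union hdisj hm2, h.prob_one, h.prob_neg_one, ENNReal.add_halves]
  exact (mem_ae_iff_prob_eq_one (hm1.union hm2)).2 hone

/-- The set `S` need not be measurable: up to a null set the event is a union of some of the `2 ^ n`
events on which all the signs are prescribed. -/
theorem measureReal_randomSum_mem {d n : ℕ} (a : Fin n → EuclideanSpace ℝ (Fin d))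
    {ξ : Fin n → Ω → ℝ} (hξ : ∀ i, IsRademacher (ξ i) μ) (hind : iIndepFun ξ μ)
    (S : Set (EuclideanSpace ℝ (Fin d))) :
    μ.real {ω | randomSum a ξ ω ∈ S} = signProb (List.ofFn a) S := by
  classical
  let sgn : Bool → ℝ := fun b => if b then 1 else -1
  let E : (Fin n → Bool) → Set Ω := fun σ => ⋂ i, ξ i ⁻¹' {sgn (σ i)}
  have hEmeas : ∀ σ, MeasurableSet (E σ) := fun σ =>
    MeasurableSet.iInter fun i => (hξ i).measurable (measurableSet_singleton _)
  have hEprob : ∀ σ, μ.real (E σ) = (1 / 2) ^ n := by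
    intro σ
    have h : μ (E σ) = ∏ i, μ (ξ i ⁻¹' {sgn (σ i)}) :=
      hind.meas_iInter fun i => ⟨{sgn (σ i)}, measurableSet_singleton _, rfl⟩
    have hi : ∀ i, μ (ξ i ⁻¹' {sgn (σ i)}) = 1 / 2 := by
      intro i
      cases hσ : σ i
      · exact (hξ i).prob_neg_one
      · exact (hξ i).prob_one
    rw [measureReal_def, h, Finset.prod_congr rfl fun i _ => hi i]
    simp
  have hsgn : ∀ b b' : Bool, sgn b = sgn b' → b = b' := by
    intro b b' h
    cases b <;> cases b' <;> simp [sgn] at h ⊢ <;> norm_num at h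
  have hEdisj : ∀ σ τ ω, ω ∈ E σ → ω ∈ E τ → σ = τ := by
    intro σ τ ω h1 h2
    funext i
    have h1i : ξ i ω = sgn (σ i) := Set.mem_iInter.1 h1 i
    have h2i : ξ i ω = sgn (τ i) := Set.mem_iInter.1 h2 i
    exact hsgn _ _ (h1i.symm.trans h2i)
  have hsum : ∀ σ, ∀ ω ∈ E σ, randomSum a ξ ω = ∑ i, sgn (σ i) • a i := by
    intro σ ω hω
    refine Finset.sum_congr rfl fun i _ => ?_
    have : ξ i ω = sgn (σ i) := Set.mem_iInter.1 hω i
    rw [this]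
  let good : Finset (Fin n → Bool) := Finset.univ.filter fun σ => ∑ i, sgn (σ i) • a i ∈ S
  have hae : {ω | randomSum a ξ ω ∈ S} =ᵐ[μ] ⋃ σ ∈ good, E σ := by
    filter_upwards [ae_all_iff.2 fun i => (hξ i).ae_eq_or] with ω hω
    have hωE : ω ∈ E fun i => decide (ξ i ω = 1) := by
      refine Set.mem_iInter.2 fun i => ?_
      rcases hω i with h | h <;> norm_num [sgn, h]
    refine propext ⟨fun h => ?_, fun h => ?_⟩
    · refine Set.mem_biUnion (Finset.mem_coe.2 (Finset.mem_filter.2 ⟨Finset.mem_univ _, ?_⟩)) hωE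
      rw [← hsum _ ω hωE]
      exact h
    · obtain ⟨σ, hσ, hωσ⟩ := Set.mem_iUnion₂.1 h
      have := (Finset.mem_filter.1 hσ).2
      rw [← hsum σ ω hωσ] at this
      exact this
  rw [measureReal_congr hae, measureReal_biUnion_finset
    (fun σ _ τ _ hne => Set.disjoint_left.2 fun ω h1 h2 => hne (hEdisj σ τ ω h1 h2))
    fun σ _ => hEmeas σ, signProb, signAvg_ofFn, Finset.sum_filter]
  refine Finset.sum_congr rfl fun σ _ => ?_
  rw [hEprob, Set.indicator_apply]
  simp [sgn]

end Rademacher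

theorem theorem1p8 (d : ℕ) (hd : 1 ≤ d) :
    ∃ C : ℝ, ∀ (S : Set (EuclideanSpace ℝ (Fin d))),
      ConvexIndependent ℝ ((↑) : S → EuclideanSpace ℝ (Fin d)) →
      ∀ (n : ℕ), 1 ≤ n →
      ∀ (a : Fin n → EuclideanSpace ℝ (Fin d)), (∀ i, a i ≠ 0) →
      ∀ (Ω : Type*) [MeasurableSpace Ω] (μ : Measure Ω) [IsProbabilityMeasure μ]
        (ξ : Fin n → Ω → ℝ), (∀ i, IsRademacher (ξ i) μ) → iIndepFun ξ μ →
        μ.real {ω | randomSum a ξ ω ∈ S} ≤ C * (n : ℝ) ^ (-((d : ℝ) / 2 ^ d)) ∧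
        μ.real {ω | randomSum a ξ ω ∈ S} ≤
          C * pointConcentration (randomSum a ξ) μ ^ (1 / ((d : ℝ) * 2 ^ (d - 1))) := by
  refine ⟨4 * d ^ 3, fun S hS n hn a ha Ω _ μ _ ξ hξ hind => ?_⟩
  have hdim : Module.finrank ℝ (EuclideanSpace ℝ (Fin d)) = d := finrank_euclideanSpace_fin
  have hconv : ConvexPositionMod ⊥ S := by
    intro t ht p hp hmem
    rw [Submodule.mem_bot, sub_eq_zero] at hmem
    exact convexIndependent_set_iff_notMem_convexHull_sdiff.1 hS t ht (hmem ▸ hp)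
  have hconc : pointConcentration (randomSum a ξ) μ =
      signConc (List.ofFn a : Multiset (EuclideanSpace ℝ (Fin d))) :=
    iSup_congr fun x => by
      simpa only [Set.mem_singleton_iff] using measureReal_randomSum_mem a hξ hind {x}
  have hcard : (List.ofFn a : Multiset (EuclideanSpace ℝ (Fin d))).card = n := by simp
  rw [measureReal_randomSum_mem a hξ hind S, hconc]
  constructor
  · have h := signProb_le_card_rpow hdim hd (List.ofFn a : Multiset _) (by simpa using ha)
      (by rw [hcard]; exact hn) hconv
    rwa [hcard] at h
  · refine (signProb_le_signConc_rpow hdim hd _ hconv).trans ?_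
    have h1 : (1 : ℝ) ≤ (d : ℝ) ^ 3 := one_le_pow₀ (by exact_mod_cast hd)
    have h2 : 0 ≤ signConc (List.ofFn a : Multiset (EuclideanSpace ℝ (Fin d))) ^
        (1 / ((d : ℝ) * 2 ^ (d - 1))) :=
      Real.rpow_nonneg (signConc_pos _).le _
    nlinarith
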